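/- Let $n,k,i$ be integers with $0\le k\le n-1$ and $i>0$, and let $[n]=\{1,\dots,n\}$. Permutations $\sigma\in S_n$ are identified with the words $\sigma(1)\sigma(2)\cdots\sigma(n)$. For a word $w=w_1\cdots w_\ell$ with distinct positive integer letters, let $\mathsf{des}(w)$ be the number of $j\in\{1,\dots,\ell-1\}$ with $w_j>w_{j+1}$ (the descents of $w$), let $\mathsf{inv}(w)$ be the number of pairs $a<b$ with $w_a>w_b$, and put $w_0=0$. * Let $\mathcal S_{n,k+1}$ be the set of pairs $(\alpha_0,\rho)$, where $\rho=\rho_1\cdots\rho_{k+1}$ is a word made of $k+1$ different numbers of $[n]$ and $\alpha_0=[n]\setminus\{\rho_1,\dots,\rho_{k+1}\}$. Put $\mathsf{des}(\alpha_0,\rho)=\mathsf{des}(\rho)+\#\{a\in\alpha_0: a>\rho_1\}$. * If $w$ is increasing, its special reverse wave and its special wave are both $w$. Otherwise let $t$ be the minimal index with $w_t>w_{t+1}$. The special reverse wave of $w$ is the prefix $w_1\cdots w_s$, where $t\le s\le\ell$ is maximal such that $w_t>w_{t+1}>\cdots>w_s>w_{t-1}$. The special wave of $w$ is $w_rw_{r+1}\cdots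 w_s$, where $1\le r\le t$ is minimal such that $w_r>w_{t+1}$, and $t<s\le\ell$ is maximal such that $w_{t+1}>w_{t+2}>\cdots>w_s>w_{r-1}$. * A hook is a word $a_1a_2\cdots a_s$ with $s\ge2$, $a_1>a_2$ and $a_2<a_3<\cdots<a_s$. Every $w$ has a unique factorization as a concatenation $w=\gamma\,\alpha^{(1)}\cdots\alpha^{(m)}$, $m\ge0$, with $\gamma$ increasing (possibly empty) and every $\alpha^{(j)}$ a hook. Put $\mathsf{lec}(w)=\sum_{j=1}^m\mathsf{inv}(\alpha^{(j)})$. The rightmost hook of $w$ is $\alpha^{(m)}$ (and $\gamma=w$ if $m=0$). Then the following four sets have the same cardinality: 1. the set of $(\alpha_0,\rho)\in\mathcal S_{n,k+1}$ with $\mathsf{des}(\alpha_0,\rho)=i$; 2. the set of $\sigma\in S_n$ with $\mathsf{des}(\sigma)=i$ whose special reverse wave has length at least $n-k$; 3. the set of $\sigma\in S_n$ with $\mathsf{des}(\sigma)=i$ whose special wave has length at least $n-k$; 4. the set of $\sigma\in S_n$ with $\mathsf{lec}(\sigma)=i$ whose rightmost hook has length at least $n-k$. -/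

import Mathlib

namespace Eulerian

/-!
Words are lists of natural numbers; letters are numbered from `1`, as `w₁ w₂ ⋯ w_ℓ`.
-/

/-- The `j`-th letter `w_j` of a word, for `1 ≤ j ≤ ℓ`, with the convention `w_0 = 0`
(indices `j > ℓ` are never used below; there the value is `0`). -/
def letter (w : List ℕ) (j : ℕ) : ℕ := (0 :: w).getD j 0

/-- The set of positions `1 ≤ j ≤ ℓ - 1` with `w_j > w_{j+1}`. -/
def descents (w : List ℕ) : Finset ℕ :=
  (Finset.Ico 1 w.length).filter fun j => letter w (j + 1) < letter w j

/-- The number of descents of a word. -/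
def des (w : List ℕ) : ℕ := (descents w).card

/-- The number of inversions of a word: pairs `1 ≤ i < j ≤ ℓ` with `w_i > w_j`. -/
def inv (w : List ℕ) : ℕ :=
  ((Finset.Icc 1 w.length ×ˢ Finset.Icc 1 w.length).filter fun p =>
    p.1 < p.2 ∧ letter w p.2 < letter w p.1).card

/-- The word `σ(1) σ(2) ⋯ σ(n)` of a permutation of `[n] = {1, …, n}`
(the element `x : Fin n` stands for the number `x + 1`). -/
def word {n : ℕ} (σ : Equiv.Perm (Fin n)) : List ℕ := List.ofFn fun j => (σ j : ℕ) + 1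

/-! ### Semipermutations -/

/-- The set `S_{n,m}` of pairs `(α₀, ρ)`, where `ρ` is a word made of `m` different numbers of
`[n]` and `α₀ = [n] \ {ρ₁, …, ρ_m}`. -/
def semiperms (n m : ℕ) : Set (Finset ℕ × List ℕ) :=
  {p | p.2.length = m ∧ p.2.Nodup ∧ (∀ x ∈ p.2, x ∈ Finset.Icc 1 n) ∧
    p.1 = Finset.Icc 1 n \ p.2.toFinset}

/-- The number of descents of `(α₀, ρ)`: the descents of the word `ρ` together with the elements
of `α₀` that are larger than `ρ₁`. -/
def semides (p : Finset ℕ × List ℕ) : ℕ :=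
  des p.2 + (p.1.filter fun a => letter p.2 1 < a).card

/-- `w_a > w_{a+1} > ⋯ > w_b`. -/
def Decreasing (w : List ℕ) (a b : ℕ) : Prop :=
  ∀ j ∈ Finset.Ico a b, letter w (j + 1) < letter w j

instance (w : List ℕ) (a b : ℕ) : Decidable (Decreasing w a b) :=
  inferInstanceAs (Decidable (∀ j ∈ Finset.Ico a b, letter w (j + 1) < letter w j))

/-! ### Special reverse waves -/

/-- The position `t` of the first descent of a word that has a descent. -/
def firstDescent (w : List ℕ) (h : (descents w).Nonempty) : ℕ := (descents w).min' h

/-- For `t` the first descent, the maximal `s` with `t ≤ s ≤ ℓ` and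
`w_t > w_{t+1} > ⋯ > w_s > w_{t-1}`. -/
def srwEnd (w : List ℕ) (t : ℕ) : ℕ :=
  Nat.findGreatest (fun s => t ≤ s ∧ Decreasing w t s ∧
    letter w (t - 1) < letter w s) w.length

/-- The special reverse wave: the prefix `w_1 ⋯ w_s`, or `w` itself if `w` has no descents. -/
def srw (w : List ℕ) : List ℕ :=
  if h : (descents w).Nonempty then w.take (srwEnd w (firstDescent w h)) else w

/-! ### Special waves -/

theorem exists_gt_firstDescent (w : List ℕ) (h : (descents w).Nonempty) :
    ∃ r, 1 ≤ r ∧ r ≤ firstDescent w h ∧ letter w (firstDescent w h + 1) < letter w r := by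
  have hm := (descents w).min'_mem h
  simp only [descents, Finset.mem_filter, Finset.mem_Ico] at hm
  exact ⟨firstDescent w h, hm.1.1, le_rfl, hm.2⟩

/-- For `t` the first descent, the minimal `r` with `1 ≤ r ≤ t` and `w_r > w_{t+1}`. -/
def swStart (w : List ℕ) (h : (descents w).Nonempty) : ℕ := Nat.find (exists_gt_firstDescent w h)

/-- For `t` the first descent and `r` as above, the maximal `s` with `t < s ≤ ℓ` and
`w_{t+1} > w_{t+2} > ⋯ > w_s > w_{r-1}`. -/
def swEnd (w : List ℕ) (t r : ℕ) : ℕ :=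
  Nat.findGreatest (fun s => t < s ∧ Decreasing w (t + 1) s ∧
    letter w (r - 1) < letter w s) w.length

/-- The special wave: the subword `w_r ⋯ w_s`, or `w` itself if `w` has no descents. -/
def sw (w : List ℕ) : List ℕ :=
  if h : (descents w).Nonempty then
    (w.take (swEnd w (firstDescent w h) (swStart w h))).drop (swStart w h - 1)
  else w

/-! ### Hook factorization -/

/-- A (nontrivial) hook: a word `a_1 a_2 ⋯ a_s`, `s ≥ 2`, with `a_1 > a_2` and
`a_2 < a_3 < ⋯ < a_s`. -/
def IsHook (α : List ℕ) : Prop :=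
  ∃ (a b : ℕ) (v : List ℕ), α = a :: b :: v ∧ b < a ∧ (b :: v).Pairwise (· < ·)

/-- `w = γ * α_1 * ⋯ * α_k` with `γ` increasing (possibly empty) and every `α_i` a hook. -/
def IsHookFactorization (w γ : List ℕ) (αs : List (List ℕ)) : Prop :=
  w = γ ++ αs.flatten ∧ γ.Pairwise (· < ·) ∧ ∀ α ∈ αs, IsHook α

/-- The hook factorization `(γ, [α_1, …, α_k])` of a word with distinct letters, computed by
reading the word from right to left; `isHookFactorization_iff` shows that it is the unique
factorization in the sense of `IsHookFactorization`. -/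
def hookFactorization : List ℕ → List ℕ × List (List ℕ)
  | [] => ([], [])
  | a :: w =>
    match hookFactorization w with
    | ([], αs) => ([a], αs)
    | (b :: γ, αs) => if a < b then (a :: b :: γ, αs) else ([], (a :: b :: γ) :: αs)

theorem hookFactorization_append (γ v : List ℕ) (αs : List (List ℕ)) (hγ : γ.Pairwise (· < ·))
    (hv : hookFactorization v = ([], αs)) : hookFactorization (γ ++ v) = (γ, αs) := by
  induction γ with
  | nil => simpa using hv
  | cons a γ ih =>
    rw [List.pairwise_cons] at hγ
    have h := ih hγ.2
    cases γ with
    | nil => simp only [List.cons_append, hookFactorization, h]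
    | cons b γ =>
      have hab : a < b := hγ.1 b (by simp)
      rw [List.cons_append, hookFactorization, h]
      simp [hab]

/-- Existence and uniqueness of the hook factorization of a word with distinct letters. -/
theorem isHookFactorization_iff {w : List ℕ} (hw : w.Nodup) (γ : List ℕ) (αs : List (List ℕ)) :
    IsHookFactorization w γ αs ↔ hookFactorization w = (γ, αs) := by
  constructor
  · rintro ⟨rfl, hγ, hα⟩
    clear hw
    refine hookFactorization_append γ _ αs hγ ?_
    clear hγ
    induction αs with
    | nil => rfl
    | cons α αs ih =>
      obtain ⟨a, b, v, rfl, hba, hbv⟩ := hα α (by simp)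
      have h := hookFactorization_append (b :: v) _ αs hbv (ih fun α h => hα α (by simp [h]))
      rw [List.flatten_cons, List.cons_append, hookFactorization, h]
      simp [not_lt.2 hba.le]
  · intro h
    induction w generalizing γ αs with
    | nil =>
      simp only [hookFactorization, Prod.mk.injEq] at h
      obtain ⟨rfl, rfl⟩ := h
      simp [IsHookFactorization]
    | cons a w ih =>
      have hnd := List.nodup_cons.1 hw
      rcases hf : hookFactorization w with ⟨_ | ⟨b, δ⟩, βs⟩
      · obtain ⟨h1, h2, h3⟩ := ih hnd.2 _ _ hf
        simp only [hookFactorization, hf, Prod.mk.injEq] at h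
        obtain ⟨rfl, rfl⟩ := h
        exact ⟨by simp [h1], by simp, h3⟩
      · obtain ⟨h1, h2, h3⟩ := ih hnd.2 _ _ hf
        simp only [hookFactorization, hf] at h
        split_ifs at h with hab
        · simp only [Prod.mk.injEq] at h
          obtain ⟨rfl, rfl⟩ := h
          refine ⟨by simp [h1], ?_, h3⟩
          refine List.pairwise_cons.2 ⟨fun x hx => ?_, h2⟩
          rcases List.mem_cons.1 hx with rfl | hx
          · exact hab
          · exact hab.trans ((List.pairwise_cons.1 h2).1 x hx)
        · simp only [Prod.mk.injEq] at h
          obtain ⟨rfl, rfl⟩ := h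
          refine ⟨by simp [h1], List.Pairwise.nil, fun α hα => ?_⟩
          rcases List.mem_cons.1 hα with rfl | hα
          · have hne : a ≠ b := by
              rintro rfl
              exact hnd.1 (by simp [h1])
            exact ⟨a, b, δ, rfl, by omega, h2⟩
          · exact h3 α hα

/-- The statistic `lec`: the total number of inversions of the hooks `α_1, …, α_k`. -/
def lec (w : List ℕ) : ℕ := ((hookFactorization w).2.map inv).sum

/-- The rightmost hook `α_k`; it is the trivial hook `γ = w` if there are no hooks (`k = 0`). -/
def rightmostHook (w : List ℕ) : List ℕ :=
  (hookFactorization w).2.getLast?.getD (hookFactorization w).1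

end Eulerian

/-!
Removing the wave from a word with a descent leaves a shorter word. For each of the pairs
(`des`, `srw`), (`des`, `sw`), (`lec`, `rightmostHook`), the word can be recovered from what is
left, the set of letters of the wave and the amount `j` that the wave contributes to the statistic;
moreover, the set and `0 < j < #letters` can be prescribed freely. So the joint distribution of the
statistic and the length of the wave obeys the same recursion for the three pairs.

A semipermutation `(α₀, ρ)` with `k + 1` letters in `ρ` is turned into a permutation by writing the
letters of `α₀` below `ρ₁` in increasing order, those above `ρ₁` in decreasing order, and then `ρ`.
This preserves the number of descents, and the first `n - k` letters of the result, which increase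
and then decrease, lie in the special reverse wave.
-/

namespace Eulerian

open scoped List

section Letters

variable {w : List ℕ} {j : ℕ}

theorem letter_cons_succ (x : ℕ) (w : List ℕ) (hj : 1 ≤ j) :
    letter (x :: w) (j + 1) = letter w j := by
  obtain ⟨j, rfl⟩ := Nat.exists_eq_add_of_le' hj
  rfl

theorem letter_eq_getElem (h₁ : 1 ≤ j) (h₂ : j ≤ w.length) : letter w j = w[j - 1] := by
  obtain ⟨j, rfl⟩ := Nat.exists_eq_add_of_le' h₁
  exact List.getD_eq_getElem w 0 h₂

theorem letter_mem (h₁ : 1 ≤ j) (h₂ : j ≤ w.length) : letter w j ∈ w :=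
  letter_eq_getElem h₁ h₂ ▸ List.getElem_mem _

theorem letter_append_of_le (a b : List ℕ) (h : j ≤ a.length) : letter (a ++ b) j = letter a j :=
  List.getD_append (0 :: a) b 0 j (Nat.lt_succ_of_le h)

theorem letter_append_length_add (a b : List ℕ) (hj : 1 ≤ j) :
    letter (a ++ b) (a.length + j) = letter b j := by
  induction a with
  | nil => simp
  | cons x a ih =>
    rw [List.cons_append, List.length_cons, add_right_comm, letter_cons_succ _ _ (by omega), ih]

theorem letter_append_cons (a : List ℕ) (x : ℕ) (b : List ℕ) :
    letter (a ++ x :: b) (a.length + 1) = x :=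
  letter_append_length_add a (x :: b) le_rfl

theorem letter_length (w : List ℕ) : letter w w.length = w.getLastD 0 := by
  rcases List.eq_nil_or_concat w with rfl | ⟨w, x, rfl⟩
  · rfl
  · simp [letter]

theorem rel_letter_of_pairwise {R : ℕ → ℕ → Prop} (h : w.Pairwise R) {i : ℕ} (hi : 1 ≤ i)
    (hij : i < j) (hj : j ≤ w.length) : R (letter w i) (letter w j) := by
  rw [letter_eq_getElem hi (hij.le.trans hj), letter_eq_getElem (hi.trans hij.le) hj]
  exact List.pairwise_iff_getElem.1 h _ _ _ _ (by omega)

theorem sum_Ico_succ_shift {M : Type*} [AddCommMonoid M] (n : ℕ) (f : ℕ → M) :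
    ∑ j ∈ Finset.Ico 1 (n + 1 + 1), f j = f 1 + ∑ j ∈ Finset.Ico 1 (n + 1), f (j + 1) := by
  rw [Finset.sum_eq_sum_Ico_succ_bot (by omega), Finset.sum_Ico_add' f 1 (n + 1) 1]

theorem sum_ite_letter_lt (x : ℕ) (w : List ℕ) :
    ∑ j ∈ Finset.Ico 1 (w.length + 1), (if letter w j < x then 1 else 0) =
      w.countP (· < x) := by
  induction w with
  | nil => rfl
  | cons y w ih =>
    rw [List.length_cons, sum_Ico_succ_shift, List.countP_cons, ← ih, add_comm]
    congr 1
    · refine Finset.sum_congr rfl fun j hj => ?_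
      rw [letter_cons_succ _ _ (Finset.mem_Ico.1 hj).1]
    · simp [letter]

end Letters

section Descents

variable {x y : ℕ} {u v w : List ℕ}

theorem mem_descents {j : ℕ} :
    j ∈ descents w ↔ (1 ≤ j ∧ j < w.length) ∧ letter w (j + 1) < letter w j := by
  rw [descents, Finset.mem_filter, Finset.mem_Ico]

theorem des_cons_cons (x y : ℕ) (w : List ℕ) :
    des (x :: y :: w) = (if y < x then 1 else 0) + des (y :: w) := by
  simp only [des, descents, Finset.card_filter, List.length_cons, sum_Ico_succ_shift]
  congr 1
  refine Finset.sum_congr rfl fun j hj => ?_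
  rw [letter_cons_succ x _ (by omega), letter_cons_succ x _ (Finset.mem_Ico.1 hj).1]

theorem des_append_cons (u : List ℕ) (x : ℕ) (v : List ℕ) :
    des (u ++ x :: v) = des (u ++ [x]) + des (x :: v) := by
  induction u with
  | nil => exact (Nat.zero_add _).symm
  | cons a u ih =>
    cases u with
    | nil => rw [List.singleton_append, List.singleton_append, des_cons_cons, des_cons_cons]; rfl
    | cons b u =>
      simp only [List.cons_append] at ih ⊢
      rw [des_cons_cons, des_cons_cons a b (u ++ [x]), ih, add_assoc]

theorem des_eq_zero_of_pairwise (h : w.Pairwise (· < ·)) : des w = 0 := by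
  rw [des, Finset.card_eq_zero, Finset.eq_empty_iff_forall_notMem]
  intro j hj
  obtain ⟨⟨h₁, h₂⟩, hlt⟩ := mem_descents.1 hj
  exact hlt.not_gt (rel_letter_of_pairwise h h₁ j.lt_succ_self h₂)

theorem des_eq_of_pairwise_gt (h : w.Pairwise (· > ·)) : des w = w.length - 1 := by
  rw [des, descents, Finset.filter_true_of_mem, Nat.card_Ico]
  intro j hj
  obtain ⟨h₁, h₂⟩ := Finset.mem_Ico.1 hj
  exact rel_letter_of_pairwise h h₁ j.lt_succ_self h₂

theorem des_cons_of_lt_head (h : ∀ y ∈ w.head?, x < y) : des (x :: w) = des w := by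
  cases w with
  | nil => rfl
  | cons y w => rw [des_cons_cons, if_neg (h y rfl).not_gt, zero_add]

theorem des_peak {d : List ℕ} (hu : (u ++ [x]).Pairwise (· < ·))
    (hd : (x :: (d ++ [y])).Pairwise (· > ·)) :
    des (u ++ x :: (d ++ y :: v)) = d.length + 1 + des (y :: v) := by
  rw [des_append_cons, des_eq_zero_of_pairwise hu, zero_add, ← List.cons_append,
    des_append_cons, List.cons_append, des_eq_of_pairwise_gt hd]
  simp

theorem nonempty_descents_of_lt (u : List ℕ) (hyx : y < x) (v : List ℕ) :
    (descents (u ++ x :: y :: v)).Nonempty := by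
  refine ⟨u.length + 1, mem_descents.2 ⟨⟨by omega, by simp⟩, ?_⟩⟩
  rw [letter_append_cons, add_assoc, letter_append_length_add _ _ (by omega)]
  exact hyx

end Descents

section Inversions

theorem inv_eq_sum (w : List ℕ) :
    inv w = ∑ i ∈ Finset.Ico 1 (w.length + 1), ∑ j ∈ Finset.Ico 1 (w.length + 1),
      if i < j ∧ letter w j < letter w i then 1 else 0 := by
  rw [inv, Finset.card_filter, Finset.sum_product]
  rfl

theorem inv_cons (x : ℕ) (w : List ℕ) : inv (x :: w) = w.countP (· < x) + inv w := by
  rw [inv_eq_sum, inv_eq_sum, List.length_cons, sum_Ico_succ_shift, ← sum_ite_letter_lt]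
  simp only [sum_Ico_succ_shift]
  congr 1
  · rw [if_neg (by omega), zero_add]
    refine Finset.sum_congr rfl fun j hj => if_congr ?_ rfl rfl
    have hj := (Finset.mem_Ico.1 hj).1
    rw [letter_cons_succ _ _ hj, and_iff_right (by omega)]
    rfl
  · refine Finset.sum_congr rfl fun i hi => ?_
    rw [if_neg (by omega), zero_add]
    refine Finset.sum_congr rfl fun j hj => ?_
    simp only [letter_cons_succ _ _ (Finset.mem_Ico.1 hi).1,
      letter_cons_succ _ _ (Finset.mem_Ico.1 hj).1, add_lt_add_iff_right]

theorem inv_eq_zero_of_pairwise {w : List ℕ} (h : w.Pairwise (· < ·)) : inv w = 0 := by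
  induction w with
  | nil => rfl
  | cons x w ih =>
    obtain ⟨hx, hw⟩ := List.pairwise_cons.1 h
    rw [inv_cons, ih hw, add_zero, List.countP_eq_zero]
    simpa using fun y hy => (hx y hy).le

theorem inv_cons_append {u r : List ℕ} {c : ℕ} (h : (u ++ c :: r).Pairwise (· < ·)) :
    inv (c :: (u ++ r)) = u.length := by
  have huc : ∀ y ∈ u, y < c := fun y hy => (List.pairwise_append.1 h).2.2 y hy c (by simp)
  have hcr : ∀ y ∈ r, c ≤ y := fun y hy => (List.rel_of_pairwise_cons
    (List.pairwise_append.1 h).2.1 hy).le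
  rw [inv_cons, inv_eq_zero_of_pairwise (h.sublist (by simp)), add_zero, List.countP_append,
    List.countP_eq_length.2 (by simpa using huc), List.countP_eq_zero.2 (by simpa using hcr),
    add_zero]

end Inversions

section Chains

variable {α : Type*} (R : α → α → Prop) [DecidableRel R]

/-- The longest prefix `d` of a list such that `x :: d` is a chain for `R`. -/
def takeChain : α → List α → List α
  | _, [] => []
  | x, y :: l => if R x y then y :: takeChain y l else []

theorem takeChain_append {x : α} {d v : List α} (hd : (x :: d).IsChain R)
    (hv : ∀ q ∈ v.head?, ¬ R (d.getLastD x) q) : takeChain R x (d ++ v) = d := by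
  induction d generalizing x with
  | nil =>
    cases v with
    | nil => rfl
    | cons q v => exact if_neg (hv q rfl)
  | cons y d ih =>
    obtain ⟨hxy, hd⟩ := List.isChain_cons_cons.1 hd
    rw [List.cons_append, takeChain, if_pos hxy, ih hd (by rwa [List.getLastD_cons] at hv)]

theorem exists_takeChain_append_eq (x : α) (l : List α) : ∃ v, takeChain R x l ++ v = l ∧
    (x :: takeChain R x l).IsChain R ∧ ∀ q ∈ v.head?, ¬ R ((takeChain R x l).getLastD x) q := by
  induction l generalizing x with
  | nil => exact ⟨[], rfl, List.isChain_singleton x, by simp⟩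
  | cons y l ih =>
    by_cases hxy : R x y
    · obtain ⟨v, hl, hd, hv⟩ := ih y
      rw [takeChain, if_pos hxy]
      exact ⟨v, by rw [List.cons_append, hl], hd.cons_cons hxy, by rwa [List.getLastD_cons]⟩
    · rw [takeChain, if_neg hxy]
      exact ⟨y :: l, rfl, List.isChain_singleton x, by simpa using hxy⟩

end Chains

theorem getLastD_mem {α : Type*} {l : List α} (h : l ≠ []) (x : α) : l.getLastD x ∈ l := by
  obtain ⟨y, l, rfl⟩ := List.exists_cons_of_ne_nil h
  rw [List.getLastD_cons]
  exact List.getLastD_mem_cons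

section FirstDescent

theorem exists_first_descent {w : List ℕ} (hnd : w.Nodup) (hw : ¬ w.Pairwise (· < ·)) :
    ∃ a x y r, w = a ++ x :: y :: r ∧ (a ++ [x]).Pairwise (· < ·) ∧ y < x := by
  cases w with
  | nil => exact (hw List.Pairwise.nil).elim
  | cons z l =>
    obtain ⟨v, hl, hd, hv⟩ := exists_takeChain_append_eq (· < ·) z l
    set d := takeChain (· < ·) z l
    obtain ⟨a, x, hax⟩ := List.eq_nil_or_concat (z :: d) |>.resolve_left (by simp)
    rw [List.concat_eq_append] at hax
    have hlast : d.getLastD z = x := by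
      rw [← List.getLastD_cons (a := z), hax, List.getLastD_concat]
    have hzl : z :: l = a ++ [x] ++ v := by rw [← hax, List.cons_append, hl]
    rw [hzl] at hnd hw
    rw [hax] at hd
    cases v with
    | nil => exact (hw (by simpa using List.isChain_iff_pairwise.1 hd)).elim
    | cons y r =>
      have hne : x ≠ y := (List.pairwise_append.1 hnd).2.2 x (by simp) y (by simp)
      have hyx : ¬ x < y := hlast ▸ hv y rfl
      exact ⟨a, x, y, r, by rw [hzl, List.append_assoc]; rfl, List.isChain_iff_pairwise.1 hd,
        by omega⟩

theorem firstDescent_append {a r : List ℕ} {x y : ℕ} (ha : (a ++ [x]).Pairwise (· < ·))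
    (hyx : y < x) (h : (descents (a ++ x :: y :: r)).Nonempty) :
    firstDescent (a ++ x :: y :: r) h = a.length + 1 := by
  have hw : a ++ x :: y :: r = a ++ [x] ++ y :: r := by simp
  have hx := letter_append_cons a x (y :: r)
  have hy := letter_append_cons (a ++ [x]) y r
  rw [← hw, List.length_append, List.length_singleton] at hy
  refine (Finset.min'_eq_iff _ h _).2 ⟨mem_descents.2 ?_, fun j hj => ?_⟩
  · simpa [hx, hy] using hyx
  · by_contra! hja
    obtain ⟨⟨h₁, -⟩, hlt⟩ := mem_descents.1 hj
    rw [hw, letter_append_of_le (a ++ [x]) _ (by simpa using hja),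
      letter_append_of_le (a ++ [x]) _ (by simpa using hja.le)] at hlt
    exact hlt.not_gt (rel_letter_of_pairwise ha h₁ j.lt_succ_self (by simpa using hja))

end FirstDescent

section DecreasingRuns

/-- The block `d` is a nonempty decreasing word with letters above `p`, and no prefix of
`d ++ v` longer than `d` is: these are the runs in which special (reverse) waves end. -/
structure IsDecreasingRun (p : ℕ) (d v : List ℕ) : Prop where
  ne_nil : d ≠ []
  pairwise : d.Pairwise (· > ·)
  lt : ∀ z ∈ d, p < z
  le_of_lt : ∀ q ∈ v.head?, q < d.getLastD 0 → q ≤ p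

variable {p : ℕ} {d v : List ℕ}

theorem exists_isDecreasingRun_append (hd : d ≠ []) (hdec : d.Pairwise (· > ·))
    (hlt : ∀ z ∈ d, p < z) (v : List ℕ) :
    ∃ e v', v = e ++ v' ∧ IsDecreasingRun p (d ++ e) v' := by
  induction v generalizing d with
  | nil => exact ⟨[], [], rfl, by simpa, by simpa, by simpa, by simp⟩
  | cons q v ih =>
    by_cases hq : q < d.getLastD 0 ∧ p < q
    · have hdec' : (d ++ [q]).Pairwise (· > ·) := by
        obtain ⟨d, x, rfl⟩ := List.eq_nil_or_concat' d |>.resolve_left hd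
        rw [List.getLastD_concat] at hq
        rw [List.append_assoc, List.singleton_append]
        rw [← List.isChain_iff_pairwise] at hdec ⊢
        exact List.isChain_split.2 ⟨hdec, List.isChain_pair.2 hq.1⟩
      obtain ⟨e, v', rfl, h⟩ := ih (by simp) hdec' (by simpa [or_imp, forall_and] using ⟨hlt, hq.2⟩)
      exact ⟨q :: e, v', rfl, by simpa using h⟩
    · exact ⟨[], q :: v, rfl, by simpa, by simpa, by simpa, by simpa using hq⟩

theorem Decreasing.letter_le {w : List ℕ} {a b : ℕ} (h : Decreasing w a b) (hab : a ≤ b) :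
    letter w b ≤ letter w a := by
  induction b, hab using Nat.le_induction with
  | base => rfl
  | succ b hab ih =>
    exact (h b (Finset.mem_Ico.2 (by omega))).le.trans
      (ih fun j hj => h j (Finset.Ico_subset_Ico_right b.le_succ hj))

theorem decreasing_append (a v : List ℕ) (hd : d.Pairwise (· > ·)) :
    Decreasing (a ++ d ++ v) (a.length + 1) (a.length + d.length) := by
  intro j hj
  obtain ⟨h₁, h₂⟩ := Finset.mem_Ico.1 hj
  obtain ⟨i, rfl⟩ := Nat.exists_eq_add_of_le (Nat.le_of_succ_le h₁)
  rw [add_assoc, letter_append_of_le (a ++ d) _ (by rw [List.length_append]; omega),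
    letter_append_of_le (a ++ d) _ (by rw [List.length_append]; omega),
    letter_append_length_add _ _ (by omega),
    letter_append_length_add _ _ (by omega)]
  exact rel_letter_of_pairwise hd (by omega) (by omega) (by omega)

theorem findGreatest_decreasing (h : IsDecreasingRun p d v) (a : List ℕ) :
    Nat.findGreatest (fun s => a.length + 1 ≤ s ∧ Decreasing (a ++ d ++ v) (a.length + 1) s ∧
      p < letter (a ++ d ++ v) s) (a ++ d ++ v).length = a.length + d.length := by
  have hpos : 1 ≤ d.length := List.length_pos_iff.2 h.ne_nil
  have hlast : letter (a ++ d ++ v) (a.length + d.length) = d.getLastD 0 := by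
    rw [letter_append_of_le _ _ (by simp), letter_append_length_add _ _ hpos, letter_length]
  refine Nat.findGreatest_eq_iff.2 ⟨by simp, fun _ => ⟨by omega, decreasing_append a v h.pairwise,
    hlast ▸ h.lt _ (getLastD_mem h.ne_nil 0)⟩, ?_⟩
  rintro s hs hsl ⟨-, hdec, hps⟩
  obtain ⟨q, v, rfl⟩ := List.exists_cons_of_ne_nil (l := v) (by
    rintro rfl
    rw [List.append_nil, List.length_append] at hsl
    omega)
  have hq := letter_append_cons (a ++ d) q v
  rw [List.length_append] at hq
  have hlt := hdec (a.length + d.length) (Finset.mem_Ico.2 (by omega))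
  have hle : letter _ s ≤ letter _ (a.length + d.length + 1) := Decreasing.letter_le
    (fun j hj => hdec j (Finset.Ico_subset_Ico_left (by omega) hj)) hs
  rw [hq] at hlt hle
  exact (hps.trans_le hle).not_ge (h.le_of_lt q rfl (hlast ▸ hlt))

end DecreasingRuns

section Waves

variable {a b d r v : List ℕ} {x y : ℕ}

theorem srw_of_pairwise {w : List ℕ} (h : w.Pairwise (· < ·)) : srw w = w := by
  rw [srw, dif_neg]
  rw [← Finset.card_pos]
  exact (des_eq_zero_of_pairwise h).not_gt

theorem sw_of_pairwise {w : List ℕ} (h : w.Pairwise (· < ·)) : sw w = w := by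
  rw [sw, dif_neg]
  rw [← Finset.card_pos]
  exact (des_eq_zero_of_pairwise h).not_gt

theorem srw_append (ha : (a ++ [x]).Pairwise (· < ·)) (hyx : y < x) (hw : d ++ v = x :: y :: r)
    (hd : IsDecreasingRun (a.getLastD 0) d v) : srw (a ++ d ++ v) = a ++ d := by
  have hw' : a ++ d ++ v = a ++ x :: y :: r := by rw [List.append_assoc, hw]
  have h : (descents (a ++ d ++ v)).Nonempty := hw' ▸ nonempty_descents_of_lt a hyx r
  have ht : firstDescent (a ++ d ++ v) h = a.length + 1 := by
    simp only [hw']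
    exact firstDescent_append ha hyx _
  have hp : letter (a ++ d ++ v) a.length = a.getLastD 0 := by
    rw [List.append_assoc, letter_append_of_le _ _ le_rfl, letter_length]
  rw [srw, dif_pos h, ht, srwEnd, Nat.add_sub_cancel, hp, findGreatest_decreasing hd,
    List.take_left' List.length_append]

theorem firstDescent_append_append (hab : (a ++ y :: b).Pairwise (· < ·)) (hb : b ≠ [])
    (h : (descents (a ++ b ++ y :: v)).Nonempty) :
    firstDescent (a ++ b ++ y :: v) h = (a ++ b).length := by
  obtain ⟨b, x, rfl⟩ := List.eq_nil_or_concat' b |>.resolve_left hb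
  have hw : a ++ (b ++ [x]) ++ y :: v = a ++ b ++ x :: y :: v := by simp
  have hyx : y < x := List.rel_of_pairwise_cons (List.pairwise_append.1 hab).2.1 (by simp)
  simp only [hw]
  rw [firstDescent_append (hab.sublist (by simp)) hyx]
  simp [add_assoc]

theorem swStart_append (hab : (a ++ y :: b).Pairwise (· < ·)) (hb : b ≠ [])
    (h : (descents (a ++ b ++ y :: v)).Nonempty) :
    swStart (a ++ b ++ y :: v) h = a.length + 1 := by
  obtain ⟨hya, hyb⟩ : (∀ z ∈ a, z < y) ∧ ∀ z ∈ b, y < z :=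
    ⟨fun z hz => (List.pairwise_append.1 hab).2.2 z hz y (by simp),
      fun z hz => List.rel_of_pairwise_cons (List.pairwise_append.1 hab).2.1 hz⟩
  refine (Nat.find_eq_iff _).2 ?_
  rw [firstDescent_append_append hab hb, letter_append_cons]
  obtain ⟨x, b, rfl⟩ := List.exists_cons_of_ne_nil hb
  refine ⟨⟨by omega, by simp, ?_⟩, ?_⟩
  · rw [List.append_assoc, List.cons_append, letter_append_cons]
    exact hyb x (by simp)
  · rintro j hj ⟨h₁, -, hlt⟩
    rw [List.append_assoc, letter_append_of_le _ _ (by omega)] at hlt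
    exact hlt.not_gt (hya _ (letter_mem h₁ (by omega)))

theorem sw_append (hab : (a ++ y :: b).Pairwise (· < ·)) (hb : b ≠ [])
    (hd : IsDecreasingRun (a.getLastD 0) (y :: d) v) :
    sw (a ++ b ++ y :: (d ++ v)) = b ++ y :: d := by
  have hend : swEnd (a ++ b ++ y :: (d ++ v)) (a ++ b).length (a.length + 1) =
      (a ++ b).length + (y :: d).length := by
    have hlast : letter (a ++ b ++ y :: (d ++ v)) a.length = a.getLastD 0 := by
      rw [List.append_assoc, letter_append_of_le _ _ le_rfl, letter_length]
    have hw : a ++ b ++ y :: (d ++ v) = a ++ b ++ y :: d ++ v := by simp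
    rw [swEnd, Nat.add_sub_cancel, hlast, hw]
    exact findGreatest_decreasing hd (a ++ b)
  have h : (descents (a ++ b ++ y :: (d ++ v))).Nonempty := by
    obtain ⟨b, x, rfl⟩ := List.eq_nil_or_concat' b |>.resolve_left hb
    simpa using nonempty_descents_of_lt (a ++ b)
      (List.rel_of_pairwise_cons (List.pairwise_append.1 hab).2.1 (by simp)) (d ++ v)
  have hw : a ++ b ++ y :: (d ++ v) = a ++ (b ++ y :: d) ++ v := by simp
  rw [sw, dif_pos h, firstDescent_append_append hab hb, swStart_append hab hb, hend,
    Nat.add_sub_cancel, hw, List.take_left' (by simp [add_assoc]), List.drop_left]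

end Waves

section Hooks

theorem hookFactorization_append_of_isHook (w : List ℕ) {α : List ℕ} (hα : IsHook α) :
    hookFactorization (w ++ α) =
      ((hookFactorization w).1, (hookFactorization w).2 ++ [α]) := by
  obtain ⟨a, b, v, rfl, hba, hv⟩ := hα
  induction w with
  | nil =>
    have htail := hookFactorization_append (b :: v) [] [] hv rfl
    rw [List.append_nil] at htail
    rw [List.nil_append, show hookFactorization [] = ([], []) from rfl, hookFactorization, htail]
    simp [not_lt.2 hba.le]
  | cons x w ih =>
    rw [List.cons_append, hookFactorization, ih, hookFactorization]
    rcases hookFactorization w with ⟨_ | ⟨c, γ⟩, αs⟩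
    · rfl
    · by_cases h : x < c <;> simp [h]

theorem hookFactorization_of_pairwise {w : List ℕ} (h : w.Pairwise (· < ·)) :
    hookFactorization w = (w, []) := by
  simpa using hookFactorization_append w [] [] h rfl

theorem lec_of_pairwise {w : List ℕ} (h : w.Pairwise (· < ·)) : lec w = 0 := by
  rw [lec, hookFactorization_of_pairwise h]
  rfl

theorem rightmostHook_of_pairwise {w : List ℕ} (h : w.Pairwise (· < ·)) : rightmostHook w = w := by
  rw [rightmostHook, hookFactorization_of_pairwise h]
  rfl

theorem lec_append_of_isHook (w : List ℕ) {α : List ℕ} (hα : IsHook α) :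
    lec (w ++ α) = lec w + inv α := by
  rw [lec, hookFactorization_append_of_isHook w hα]
  simp [lec]

theorem rightmostHook_append_of_isHook (w : List ℕ) {α : List ℕ} (hα : IsHook α) :
    rightmostHook (w ++ α) = α := by
  rw [rightmostHook, hookFactorization_append_of_isHook w hα]
  simp

theorem exists_append_isHook {w : List ℕ} (hnd : w.Nodup) (hw : ¬ w.Pairwise (· < ·)) :
    ∃ v α, w = v ++ α ∧ IsHook α := by
  obtain ⟨hfac, hγ, hhook⟩ := (isHookFactorization_iff hnd _ _).2 (rfl : hookFactorization w = _)
  rcases List.eq_nil_or_concat' (hookFactorization w).2 with hnil | ⟨αs, α, hαs⟩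
  · rw [hnil, List.flatten_nil, List.append_nil] at hfac
    exact (hw (hfac ▸ hγ)).elim
  · rw [hαs] at hfac hhook
    exact ⟨(hookFactorization w).1 ++ αs.flatten, α, by simpa using hfac, hhook α (by simp)⟩

end Hooks

/-- The data that a nonincreasing word is decomposed into: the letters `l` of its wave in
increasing order, the contribution `j` of the wave to the statistic, and the word `v` that is left
when the wave is removed. Including `0` in `nodup` makes the letters positive. -/
structure IsWaveDatum (l : List ℕ) (j : ℕ) (v : List ℕ) : Prop where
  pairwise : l.Pairwise (· < ·)
  nodup : (0 :: (l ++ v)).Nodup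
  pos : 0 < j
  lt_length : j < l.length

/-- A statistic and a notion of wave that admit a `code`, putting together words from wave data,
such that waves contribute additively to the statistic. -/
structure IsWaveCoding (stat : List ℕ → ℕ) (wave : List ℕ → List ℕ)
    (code : List ℕ → ℕ → List ℕ → List ℕ) : Prop where
  stat_of_pairwise {w : List ℕ} : w.Pairwise (· < ·) → stat w = 0
  wave_of_pairwise {w : List ℕ} : w.Pairwise (· < ·) → wave w = w
  perm_code {l : List ℕ} {j : ℕ} {v : List ℕ} : IsWaveDatum l j v → code l j v ~ l ++ v
  sublist_code {l : List ℕ} {j : ℕ} {v : List ℕ} : IsWaveDatum l j v → v <+ code l j v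
  perm_wave {l : List ℕ} {j : ℕ} {v : List ℕ} : IsWaveDatum l j v → wave (code l j v) ~ l
  stat_code {l : List ℕ} {j : ℕ} {v : List ℕ} : IsWaveDatum l j v → stat (code l j v) = j + stat v
  exists_code_eq {w : List ℕ} : (0 :: w).Nodup → ¬ w.Pairwise (· < ·) →
    ∃ l j v, IsWaveDatum l j v ∧ code l j v = w

/-- The words `v` left of the words with letters `s`, statistic `i` and a wave of length at least
`m`, when that wave has the letters `a.1` and the contribution `a.2`. -/
def waveFiber (stat : List ℕ → ℕ) (s : List ℕ) (i m : ℕ) (a : List ℕ × ℕ) : Set (List ℕ) :=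
  {v | IsWaveDatum a.1 a.2 v ∧ a.1 ++ v ~ s ∧ a.2 + stat v = i ∧ m ≤ a.1.length}

theorem waveFiber_eq_empty_or (s : List ℕ) (i m : ℕ) (a : List ℕ × ℕ) :
    (∀ stat, waveFiber stat s i m a = ∅) ∨ ∃ u, IsWaveDatum a.1 a.2 u ∧ a.1 ++ u ~ s ∧
      ∀ stat, waveFiber stat s i m a = {v | v ~ u ∧ stat v = i - a.2} := by
  obtain ⟨l, j⟩ := a
  by_cases h : (∃ u, IsWaveDatum l j u ∧ l ++ u ~ s) ∧ j ≤ i ∧ m ≤ l.length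
  · obtain ⟨⟨u, hu, hus⟩, hji, hm⟩ := h
    refine Or.inr ⟨u, hu, hus, fun stat => Set.ext fun v => ⟨?_, ?_⟩⟩
    · rintro ⟨-, hvs, hstat, -⟩
      exact ⟨(List.perm_append_left_iff l).1 (hvs.trans hus.symm), Nat.eq_sub_of_add_eq' hstat⟩
    · rintro ⟨hvu, hstat⟩
      have hluv : l ++ v ~ l ++ u := hvu.append_left l
      exact ⟨⟨hu.pairwise, (hluv.cons 0).nodup_iff.2 hu.nodup, hu.pos, hu.lt_length⟩,
        hluv.trans hus, by rw [hstat, Nat.add_sub_of_le hji], hm⟩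
  · refine Or.inl fun stat => Set.eq_empty_iff_forall_notMem.2 ?_
    rintro v ⟨hv, hvs, hstat, hm⟩
    exact h ⟨⟨v, hv, hvs⟩, Nat.le.intro hstat, hm⟩

theorem mk_fiberwise_eq.{u, v} {α : Type u} {β γ : Type v} {s : α → Set β} {t : α → Set γ}
    (h : ∀ a, Cardinal.mk (s a) = Cardinal.mk (t a)) :
    Cardinal.mk {x : α × β // x.2 ∈ s x.1} = Cardinal.mk {x : α × γ // x.2 ∈ t x.1} :=
  Cardinal.mk_congr <| (Equiv.subtypeProdEquivSigmaSubtype fun a b => b ∈ s a).trans <|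
    (Equiv.sigmaCongrRight fun a => (Cardinal.eq.1 (h a)).some).trans
      (Equiv.subtypeProdEquivSigmaSubtype _).symm

namespace IsWaveCoding

variable {stat stat₁ stat₂ : List ℕ → ℕ} {wave wave₁ wave₂ : List ℕ → List ℕ}
  {code code₁ code₂ : List ℕ → ℕ → List ℕ → List ℕ} {s : List ℕ}

theorem stat_eq_zero_iff (h : IsWaveCoding stat wave code) {w : List ℕ} (hw : (0 :: w).Nodup) :
    stat w = 0 ↔ w.Pairwise (· < ·) := by
  refine ⟨fun h₀ => ?_, h.stat_of_pairwise⟩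
  by_contra hinc
  obtain ⟨l, j, v, hd, rfl⟩ := h.exists_code_eq hw hinc
  have := h.stat_code hd
  have := hd.pos
  omega

theorem code_inj (h : IsWaveCoding stat wave code) {l l' v v' : List ℕ} {j j' : ℕ}
    (hd : IsWaveDatum l j v) (hd' : IsWaveDatum l' j' v') (heq : code l j v = code l' j' v') :
    l = l' ∧ j = j' ∧ v = v' := by
  obtain rfl : l = l' := List.Perm.eq_of_pairwise' hd.pairwise hd'.pairwise
    ((h.perm_wave hd).symm.trans (heq ▸ h.perm_wave hd'))
  have hv : v ~ v' := (List.perm_append_left_iff l).1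
    ((h.perm_code hd).symm.trans (heq ▸ h.perm_code hd'))
  have hnd : (code l j v).Nodup := (h.perm_code hd).nodup_iff.2 hd.nodup.of_cons
  obtain rfl := (hnd.perm_iff_eq_of_sublist (h.sublist_code hd) (heq ▸ h.sublist_code hd')).1 hv
  refine ⟨rfl, ?_, rfl⟩
  simpa [h.stat_code hd, h.stat_code hd'] using congrArg stat heq

theorem bijOn (h : IsWaveCoding stat wave code) (hs : (0 :: s).Nodup) {i : ℕ} (hi : i ≠ 0)
    (m : ℕ) :
    Set.BijOn (fun x : (List ℕ × ℕ) × List ℕ => code x.1.1 x.1.2 x.2)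
      {x | x.2 ∈ waveFiber stat s i m x.1}
      {w | w ~ s ∧ stat w = i ∧ m ≤ (wave w).length} := by
  refine ⟨?_, ?_, ?_⟩
  · rintro ⟨⟨l, j⟩, v⟩ ⟨hd, hls, hstat, hm⟩
    exact ⟨(h.perm_code hd).trans hls, (h.stat_code hd).trans hstat,
      hm.trans_eq (h.perm_wave hd).length_eq.symm⟩
  · rintro ⟨⟨l, j⟩, v⟩ ⟨hd, -⟩ ⟨⟨l', j'⟩, v'⟩ ⟨hd', -⟩ heq
    obtain ⟨rfl, rfl, rfl⟩ := h.code_inj hd hd' heq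
    rfl
  · rintro w ⟨hws, hstat, hm⟩
    have hw : (0 :: w).Nodup := (hws.cons 0).nodup_iff.2 hs
    obtain ⟨l, j, v, hd, rfl⟩ := h.exists_code_eq hw
      fun hinc => hi (hstat ▸ h.stat_of_pairwise hinc)
    exact ⟨((l, j), v), ⟨hd, (h.perm_code hd).symm.trans hws, h.stat_code hd ▸ hstat,
      hm.trans_eq (h.perm_wave hd).length_eq⟩, rfl⟩

theorem setOf_stat_eq_zero (h : IsWaveCoding stat wave code) (hs : (0 :: s).Nodup) (m : ℕ) :
    {w | w ~ s ∧ stat w = 0 ∧ m ≤ (wave w).length} =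
      {w | w ~ s ∧ w.Pairwise (· < ·) ∧ m ≤ w.length} := by
  ext w
  refine and_congr_right fun hws => ?_
  rw [h.stat_eq_zero_iff ((hws.cons 0).nodup_iff.2 hs)]
  refine and_congr_right fun hinc => ?_
  rw [h.wave_of_pairwise hinc]

/-- By strong induction on the number of letters: removing the wave leaves a shorter word, on which
the two statistics are equidistributed. -/
theorem mk_eq (h₁ : IsWaveCoding stat₁ wave₁ code₁) (h₂ : IsWaveCoding stat₂ wave₂ code₂)
    (hs : (0 :: s).Nodup) (i m : ℕ) :
    Cardinal.mk {w // w ~ s ∧ stat₁ w = i ∧ m ≤ (wave₁ w).length} =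
      Cardinal.mk {w // w ~ s ∧ stat₂ w = i ∧ m ≤ (wave₂ w).length} := by
  induction hn : s.length using Nat.strong_induction_on generalizing s i m with | _ n ih => ?_
  subst hn
  rcases eq_or_ne i 0 with rfl | hi
  · exact congrArg (fun t : Set (List ℕ) => Cardinal.mk t)
      ((h₁.setOf_stat_eq_zero hs m).trans (h₂.setOf_stat_eq_zero hs m).symm)
  refine (Cardinal.mk_congr (h₁.bijOn hs hi m).equiv).symm.trans <|
    Eq.trans ?_ (Cardinal.mk_congr (h₂.bijOn hs hi m).equiv)
  refine mk_fiberwise_eq (s := waveFiber stat₁ s i m) (t := waveFiber stat₂ s i m) fun a => ?_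
  rcases waveFiber_eq_empty_or s i m a with hempty | ⟨u, hu, hus, hfiber⟩
  · rw [hempty, hempty]
  · have hlt : u.length < s.length := by
      have := hu.lt_length
      rw [← hus.length_eq, List.length_append]
      omega
    rw [hfiber, hfiber]
    have heq := ih _ hlt (hu.nodup.sublist (by simp)) (i - a.2) 0 rfl
    simp only [Nat.zero_le, and_true] at heq
    exact heq

end IsWaveCoding

section Splitting

theorem exists_append_cons_pairwise {α : Type*} [LinearOrder α] {s : List α} {c : α}
    (hs : s.Pairwise (· < ·)) (hc : c ∉ s) :
    ∃ u r, s = u ++ r ∧ (u ++ c :: r).Pairwise (· < ·) := by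
  induction s with
  | nil => exact ⟨[], [], rfl, List.pairwise_singleton _ c⟩
  | cons x s ih =>
    rw [List.mem_cons, not_or] at hc
    rcases lt_or_gt_of_ne hc.1 with hcx | hxc
    · refine ⟨[], x :: s, rfl, List.pairwise_cons.2 ⟨?_, hs⟩⟩
      rintro y (_ | ⟨_, hy⟩)
      exacts [hcx, hcx.trans (List.rel_of_pairwise_cons hs hy)]
    · obtain ⟨u, r, rfl, hucr⟩ := ih hs.of_cons hc.2
      refine ⟨x :: u, r, rfl, List.pairwise_cons.2 ⟨fun y hy => ?_, hucr⟩⟩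
      rcases List.mem_cons.1 (List.perm_middle.subset hy) with rfl | hy
      exacts [hxc, List.rel_of_pairwise_cons hs hy]

theorem exists_eq_append_cons {α : Type*} {l : List α} {j : ℕ} (hj : j < l.length) :
    ∃ u c r, l = u ++ c :: r ∧ u.length = j :=
  ⟨l.take j, l[j], l.drop (j + 1), by simp, List.length_take_of_le hj.le⟩

end Splitting

section HookCoding

variable {l u r : List ℕ} {c j : ℕ}

/-- The hook with increasing list of letters `l` and `j` inversions: its first letter is the letter
of index `j` (counted from `0`) of `l`. -/
def hookWord (l : List ℕ) (j : ℕ) : List ℕ := l.getD j 0 :: l.eraseIdx j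

theorem hookWord_append_cons (u : List ℕ) (c : ℕ) (r : List ℕ) :
    hookWord (u ++ c :: r) u.length = c :: (u ++ r) := by
  simp [hookWord, List.eraseIdx_append_of_length_le]

theorem hookWord_perm (hj : j < l.length) : hookWord l j ~ l := by
  obtain ⟨u, c, r, rfl, rfl⟩ := exists_eq_append_cons hj
  rw [hookWord_append_cons]
  exact List.perm_middle.symm

theorem isHook_cons_append (h : (u ++ c :: r).Pairwise (· < ·)) (hu : u ≠ []) :
    IsHook (c :: (u ++ r)) := by
  obtain ⟨b, u, rfl⟩ := List.exists_cons_of_ne_nil hu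
  exact ⟨c, b, u ++ r, rfl, List.rel_of_pairwise_cons h (by simp), h.sublist (by simp)⟩

theorem isHook_hookWord (hl : l.Pairwise (· < ·)) (h₀ : 0 < j) (hj : j < l.length) :
    IsHook (hookWord l j) := by
  obtain ⟨u, c, r, rfl, rfl⟩ := exists_eq_append_cons hj
  rw [hookWord_append_cons]
  exact isHook_cons_append hl (List.length_pos_iff.1 h₀)

theorem inv_hookWord (hl : l.Pairwise (· < ·)) (hj : j < l.length) : inv (hookWord l j) = j := by
  obtain ⟨u, c, r, rfl, rfl⟩ := exists_eq_append_cons hj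
  rw [hookWord_append_cons, inv_cons_append hl]

theorem IsHook.exists_hookWord_eq {α : List ℕ} (hα : IsHook α) (hnd : α.Nodup) :
    ∃ l j, l.Pairwise (· < ·) ∧ 0 < j ∧ j < l.length ∧ hookWord l j = α := by
  obtain ⟨a, b, v, rfl, hba, hv⟩ := hα
  obtain ⟨u, r, hur, hpw⟩ := exists_append_cons_pairwise hv (List.nodup_cons.1 hnd).1
  refine ⟨u ++ a :: r, u.length, hpw, List.length_pos_iff.2 ?_, by simp,
    by rw [hookWord_append_cons, hur]⟩
  rintro rfl
  rw [List.nil_append] at hur hpw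
  exact hba.not_gt (List.rel_of_pairwise_cons hpw (by simp [← hur]))

theorem isWaveCoding_hook :
    IsWaveCoding lec rightmostHook fun l j v => v ++ hookWord l j where
  stat_of_pairwise := lec_of_pairwise
  wave_of_pairwise := rightmostHook_of_pairwise
  perm_code h := ((hookWord_perm h.lt_length).append_left _).trans List.perm_append_comm
  sublist_code _ := List.sublist_append_left _ _
  perm_wave h := by
    rw [rightmostHook_append_of_isHook _ (isHook_hookWord h.pairwise h.pos h.lt_length)]
    exact hookWord_perm h.lt_length
  stat_code h := by
    rw [lec_append_of_isHook _ (isHook_hookWord h.pairwise h.pos h.lt_length),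
      inv_hookWord h.pairwise h.lt_length, add_comm]
  exists_code_eq {w} hw hinc := by
    obtain ⟨v, α, rfl, hα⟩ := exists_append_isHook hw.of_cons hinc
    obtain ⟨l, j, hl, h₀, hj, rfl⟩ := hα.exists_hookWord_eq (List.nodup_append.1 hw.of_cons).2.1
    have hperm : l ++ v ~ v ++ hookWord l j :=
      ((hookWord_perm hj).symm.append_right v).trans List.perm_append_comm
    exact ⟨l, j, v, ⟨hl, (hperm.cons 0).nodup_iff.2 hw, h₀, hj⟩, rfl⟩

end HookCoding

section PositiveLetters

variable {l u t : List ℕ}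

theorem pairwise_zero_cons (hnd : (0 :: l).Nodup) (h : l.Pairwise (· < ·)) :
    (0 :: l).Pairwise (· < ·) :=
  List.pairwise_cons.2 ⟨fun _ hy => Nat.pos_of_ne_zero
    fun h₀ => (List.nodup_cons.1 hnd).1 (h₀ ▸ hy), h⟩

theorem pairwise_zero_cons_append : (0 :: (u ++ t)).Pairwise (· < ·) ↔
    (0 :: u).Pairwise (· < ·) ∧ t.Pairwise (· < ·) ∧ ∀ z ∈ t, u.getLastD 0 < z := by
  rw [← List.cons_append, List.pairwise_append]
  refine and_congr_right fun hu => and_congr_right fun _ =>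
    ⟨fun h => h _ List.getLastD_mem_cons, fun h y hy z hz => ?_⟩
  refine lt_of_le_of_lt ?_ (h z hz)
  rcases List.eq_nil_or_concat' u with rfl | ⟨u, x, rfl⟩
  · simpa using hy
  · rw [List.getLastD_concat]
    rcases List.mem_append.1 (show y ∈ (0 :: u) ++ [x] from hy) with hy | hy
    · exact ((List.pairwise_append.1 hu).2.2 y hy x (by simp)).le
    · exact (List.mem_singleton.1 hy).le

theorem isDecreasingRun_reverse {v : List ℕ} (h : (0 :: (u ++ t)).Pairwise (· < ·)) (ht : t ≠ [])
    (hv : ∀ q ∈ v.head?, q < t.headD 0 → q ≤ u.getLastD 0) :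
    IsDecreasingRun (u.getLastD 0) t.reverse v where
  ne_nil := by simpa
  pairwise := List.pairwise_reverse.2 (List.pairwise_append.1 h.of_cons).2.1
  lt z hz := (pairwise_zero_cons_append.1 h).2.2 z (List.mem_reverse.1 hz)
  le_of_lt := by
    obtain ⟨c, t, rfl⟩ := List.exists_cons_of_ne_nil ht
    rwa [List.reverse_cons, List.getLastD_concat]

end PositiveLetters

section SrwCoding

variable {l u r v w : List ℕ} {c j q : ℕ}

/-- The word `w` whose special reverse wave has the letters `l` and contributes `j` descents, while
`v` is left when it is removed. The first descent is at the greatest letter of `l`, so that `w`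
consists of an increasing prefix, a decreasing block of letters of `l`, and `v`; the letter of `l`
with exactly `j` greater ones is the last of the block if it does not form a descent with the first
letter of `v`, and the last of the prefix otherwise. -/
def srwCode (l : List ℕ) (j : ℕ) (v : List ℕ) : List ℕ :=
  let k := l.length - (j + 1)
  let i := if ∀ q ∈ v.head?, l.getD k 0 < q then k else k + 1
  l.take i ++ (l.drop i).reverse ++ v

theorem srwCode_of_lt (hv : ∀ q ∈ v.head?, c < q) :
    srwCode (u ++ c :: r) r.length v = u ++ (c :: r).reverse ++ v := by
  have hk : (u ++ c :: r).length - (r.length + 1) = u.length := by simp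
  have hc : (u ++ c :: r).getD u.length 0 = c := by simp
  rw [srwCode, hk, hc, if_pos hv, List.take_left, List.drop_left]

theorem srwCode_of_gt (hqc : q < c) (v : List ℕ) :
    srwCode (u ++ c :: r) r.length (q :: v) = u ++ [c] ++ r.reverse ++ q :: v := by
  have hk : (u ++ c :: r).length - (r.length + 1) = u.length := by simp
  have hc : (u ++ c :: r).getD u.length 0 = c := by simp
  have hq : ¬ ∀ q' ∈ (q :: v).head?, c < q' := fun h => hqc.not_gt (h q rfl)
  rw [srwCode, hk, hc, if_neg hq, List.append_cons u c r, List.take_left' (by simp),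
    List.drop_left' (by simp)]

theorem srwCode_perm (l : List ℕ) (j : ℕ) (v : List ℕ) : srwCode l j v ~ l ++ v := by
  refine List.Perm.append_right v ?_
  exact ((List.reverse_perm _).append_left _).trans (by rw [List.take_append_drop])

theorem IsWaveDatum.srw_cases (h : IsWaveDatum l j v) : ∃ u c r x,
    l = u ++ c :: (r ++ [x]) ∧ j = (r ++ [x]).length ∧
      (0 :: (u ++ c :: (r ++ [x]))).Pairwise (· < ·) ∧
      ((∀ q ∈ v.head?, c < q) ∨ ∃ q v', v = q :: v' ∧ q < c) := by
  have hlt := h.lt_length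
  obtain ⟨u, c, r, rfl, hu⟩ := exists_eq_append_cons (l := l) (j := l.length - (j + 1)) (by omega)
  obtain rfl : j = r.length := by
    simp only [List.length_append, List.length_cons] at hlt hu
    omega
  obtain ⟨r, x, rfl⟩ := List.eq_nil_or_concat' r |>.resolve_left (List.length_pos_iff.1 h.pos)
  have hl := pairwise_zero_cons (h.nodup.sublist (by simp)) h.pairwise
  refine ⟨u, c, r, x, rfl, rfl, hl, ?_⟩
  rcases v with _ | ⟨q, v⟩
  · simp
  · have hcq : c ≠ q := (List.nodup_append.1 h.nodup.of_cons).2.2 c (by simp) q (by simp)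
    rcases lt_or_gt_of_ne hcq with hlt | hlt
    exacts [Or.inl (by simpa using hlt), Or.inr ⟨q, v, rfl, hlt⟩]

theorem des_srwCode (h : IsWaveDatum l j v) : des (srwCode l j v) = j + des v := by
  obtain ⟨u, c, r, x, rfl, rfl, hl, hv⟩ := h.srw_cases
  have hr : (c :: (r ++ [x])).Pairwise (· < ·) := (List.pairwise_append.1 hl.of_cons).2.1
  rcases hv with hv | ⟨q, v, rfl, hqc⟩
  · have hpeak := des_peak (u := u) (x := x) (d := r.reverse) (y := c) (v := v)
      (hl.of_cons.sublist (by simp)) (by simpa using List.pairwise_reverse.2 hr)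
    rw [srwCode_of_lt hv, ← des_cons_of_lt_head hv]
    simpa using hpeak
  · have hqr : (q :: (r ++ [x])).Pairwise (· < ·) :=
      List.pairwise_cons.2 ⟨fun z hz => hqc.trans (List.rel_of_pairwise_cons hr hz), hr.of_cons⟩
    have hpeak := des_peak (u := u ++ [c]) (x := x) (d := r.reverse) (y := q) (v := v)
      (hl.of_cons.sublist (by simp)) (by simpa using List.pairwise_reverse.2 hqr)
    rw [srwCode_of_gt hqc]
    simpa using hpeak

theorem srw_reverse_append {t : List ℕ} {x : ℕ} (h : (0 :: (u ++ (t ++ [x]))).Pairwise (· < ·))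
    (hx : t = [] → ∃ q ∈ v.head?, q < x)
    (hv : ∀ q ∈ v.head?, q < (t ++ [x]).headD 0 → q ≤ u.getLastD 0) :
    srw (u ++ (t ++ [x]).reverse ++ v) = u ++ (t ++ [x]).reverse := by
  have htx := (List.pairwise_append.1 (List.pairwise_append.1 h.of_cons).2.1).2.2
  obtain ⟨y, s, hys, hyx⟩ : ∃ y s, t.reverse ++ v = y :: s ∧ y < x := by
    rcases List.eq_nil_or_concat' t with rfl | ⟨t, y, rfl⟩
    · obtain ⟨q, hq, hqx⟩ := hx rfl
      exact ⟨q, v.tail, List.eq_cons_of_mem_head? hq, hqx⟩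
    · exact ⟨y, t.reverse ++ v, by simp, htx y (by simp) x (by simp)⟩
  exact srw_append (r := s) (h.of_cons.sublist (by simp)) hyx (by simp [hys])
    (isDecreasingRun_reverse h (by simp) hv)

theorem srw_srwCode_perm (h : IsWaveDatum l j v) : srw (srwCode l j v) ~ l := by
  obtain ⟨u, c, r, x, rfl, rfl, hl, hv | ⟨q, v, rfl, hqc⟩⟩ := h.srw_cases
  · rw [srwCode_of_lt hv, ← List.cons_append, srw_reverse_append hl (by simp)]
    · exact (List.reverse_perm _).append_left u
    · exact fun q hq hqc => ((hv q hq).not_gt hqc).elim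
  · rw [srwCode_of_gt hqc, srw_reverse_append (by simpa using hl)]
    · simpa using ((List.reverse_perm (r ++ [x])).cons c).append_left u
    · have hcx : c < x :=
        List.rel_of_pairwise_cons (List.pairwise_append.1 hl.of_cons).2.1 (by simp)
      exact fun _ => ⟨q, rfl, hqc.trans hcx⟩
    · intro q' hq' _
      obtain rfl : q = q' := by simpa using hq'
      simpa using hqc.le

theorem exists_eq_append_reverse_append (hw : (0 :: w).Nodup) (hinc : ¬ w.Pairwise (· < ·)) :
    ∃ u t x v, w = u ++ (t ++ [x]).reverse ++ v ∧ (0 :: (u ++ (t ++ [x]))).Pairwise (· < ·) ∧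
      (t = [] → ∃ q ∈ v.head?, q < x) ∧
      ∀ q ∈ v.head?, q < (t ++ [x]).headD 0 → q ≤ u.getLastD 0 := by
  obtain ⟨u, x, y, s, rfl, hux, hyx⟩ := exists_first_descent hw.of_cons hinc
  obtain ⟨hu, -, hlt⟩ :=
    pairwise_zero_cons_append.1 (pairwise_zero_cons (hw.sublist (by simp)) hux)
  obtain ⟨d, v, hdv, hd⟩ := exists_isDecreasingRun_append (by simp) (by simp) hlt (y :: s)
  refine ⟨u, d.reverse, x, v, by simp [hdv], pairwise_zero_cons_append.2 ⟨hu, ?_, ?_⟩, ?_, ?_⟩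
  · simpa using List.pairwise_reverse.2 hd.pairwise
  · simpa [or_comm] using hd.lt
  · intro h
    obtain rfl : d = [] := by simpa using h
    obtain rfl : y :: s = v := hdv
    exact ⟨y, rfl, hyx⟩
  · simpa [List.getLastD_eq_getLast?, List.getLast?_cons] using hd.le_of_lt

theorem isWaveDatum_of_nodup_srwCode (hnd : (0 :: srwCode (u ++ c :: r) r.length v).Nodup)
    (hl : (u ++ c :: r).Pairwise (· < ·)) (hr : r ≠ []) :
    IsWaveDatum (u ++ c :: r) r.length v :=
  ⟨hl, ((srwCode_perm _ _ _).cons 0).nodup_iff.1 hnd, List.length_pos_iff.2 hr,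
    by rw [List.length_append, List.length_cons]; omega⟩

theorem exists_srwCode_eq (hw : (0 :: w).Nodup) (hinc : ¬ w.Pairwise (· < ·)) :
    ∃ l j v, IsWaveDatum l j v ∧ srwCode l j v = w := by
  obtain ⟨u, t, x, v, rfl, hut, hx, hv⟩ := exists_eq_append_reverse_append hw hinc
  have hne (c) (hc : c ∈ u ++ (t ++ [x])) (q) (hq : q ∈ v) : c ≠ q :=
    (List.nodup_append.1 hw.of_cons).2.2 c (by simpa [or_comm] using hc) q hq
  by_cases hq : ∃ q ∈ v.head?, q < (t ++ [x]).headD 0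
  · obtain ⟨q, hqv, hq⟩ := hq
    have hqu := hv q hqv hq
    obtain ⟨v, rfl⟩ := List.head?_eq_some_iff.1 hqv
    obtain ⟨u, c, rfl⟩ := List.eq_nil_or_concat' u |>.resolve_left
      (by rintro rfl; exact (List.nodup_cons.1 hw).1 (by simp [Nat.le_zero.1 hqu]))
    rw [List.getLastD_concat] at hqu
    have hqc : q < c := hqu.lt_of_ne (hne c (by simp) q (by simp)).symm
    rw [← srwCode_of_gt hqc] at hw ⊢
    exact ⟨_, _, _, isWaveDatum_of_nodup_srwCode hw (by simpa using hut.of_cons) (by simp), rfl⟩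
  · push Not at hq
    obtain ⟨c, t, rfl⟩ := List.exists_cons_of_ne_nil (l := t)
      (by rintro rfl; obtain ⟨q, hqv, hqx⟩ := hx rfl; exact (hq q hqv).not_gt hqx)
    have hcv : ∀ q ∈ v.head?, c < q := fun q hqv =>
      (hq q hqv).lt_of_ne (hne c (by simp) q (List.mem_of_mem_head? hqv))
    rw [List.cons_append, ← srwCode_of_lt hcv] at hw ⊢
    exact ⟨_, _, _, isWaveDatum_of_nodup_srwCode hw hut.of_cons (by simp), rfl⟩

theorem isWaveCoding_srw : IsWaveCoding des srw srwCode where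
  stat_of_pairwise := des_eq_zero_of_pairwise
  wave_of_pairwise := srw_of_pairwise
  perm_code _ := srwCode_perm _ _ _
  sublist_code _ := List.sublist_append_right _ _
  perm_wave := srw_srwCode_perm
  stat_code := des_srwCode
  exists_code_eq := exists_srwCode_eq

end SrwCoding

section SwCoding

variable {l a b t v w : List ℕ} {j m : ℕ}

theorem des_concat (ha : a.Pairwise (· < ·)) (q : ℕ) :
    des (a ++ [q]) = if q < a.getLastD 0 then 1 else 0 := by
  rcases List.eq_nil_or_concat' a with rfl | ⟨a, x, rfl⟩
  · rfl
  · rw [List.getLastD_concat, List.append_assoc, List.singleton_append, des_append_cons,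
      des_eq_zero_of_pairwise ha, des_cons_cons, zero_add]
    rfl

theorem des_append_eq_des_cons (ha : (a ++ [m]).Pairwise (· < ·))
    (hv : ∀ q ∈ v.head?, q < m → q < a.getLastD 0) : des (a ++ v) = des (m :: v) := by
  obtain ⟨ha, -, ham⟩ := List.pairwise_append.1 ha
  cases v with
  | nil =>
    rw [List.append_nil, des_eq_zero_of_pairwise ha,
      des_eq_zero_of_pairwise (List.pairwise_singleton _ m)]
  | cons q v =>
    rw [des_append_cons, des_cons_cons, des_concat ha]
    refine congrArg (· + _) (if_congr ⟨fun h => h.trans ?_, hv q rfl⟩ rfl rfl)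
    rcases eq_or_ne a [] with rfl | hne
    · simp at h
    · exact ham _ (getLastD_mem hne 0) m (by simp)

/-- The word whose special wave has the letters `l` and contributes `j` descents, while `v` is left
when it is removed: the wave consists of the letters of `l` of index at least `j` in increasing
order and the `j` smallest ones in decreasing order, and it is inserted after the longest
increasing prefix of `v` with letters below those of `l`. -/
def swCode (l : List ℕ) (j : ℕ) (v : List ℕ) : List ℕ :=
  let a := takeChain (fun x y => x < y ∧ y < l.headD 0) 0 v
  a ++ l.drop j ++ (l.take j).reverse ++ v.drop a.length

/-- The lists `a`, `t`, `b`, `v` for which `a ++ b ++ t.reverse ++ v` is a word with special wave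
`b ++ t.reverse`. -/
structure IsSwDecomposition (a t b v : List ℕ) : Prop where
  pairwise : (0 :: (a ++ (t ++ b))).Pairwise (· < ·)
  left_ne_nil : t ≠ []
  right_ne_nil : b ≠ []
  le_of_lt : ∀ q ∈ v.head?, q < t.headD 0 → q ≤ a.getLastD 0

namespace IsSwDecomposition

theorem swCode_eq (h : IsSwDecomposition a t b v) :
    swCode (t ++ b) t.length (a ++ v) = a ++ b ++ t.reverse ++ v := by
  obtain ⟨m, t, rfl⟩ := List.exists_cons_of_ne_nil h.left_ne_nil
  have hchain : takeChain (fun x y => x < y ∧ y < m) 0 (a ++ v) = a := by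
    have ham : ((0 :: a) ++ [m]).Pairwise (· < ·) := h.pairwise.sublist (by simp)
    obtain ⟨ha, -, ham⟩ := List.pairwise_append.1 ham
    refine takeChain_append _ (List.Pairwise.isChain ?_) fun q hq hlt => ?_
    · exact ha.imp_of_mem fun _ hy hxy => ⟨hxy, ham _ hy m (by simp)⟩
    · exact (h.le_of_lt q hq hlt.2).not_gt hlt.1
  simp [swCode, hchain]

theorem sw_eq (h : IsSwDecomposition a t b v) :
    sw (a ++ b ++ t.reverse ++ v) = b ++ t.reverse := by
  have hrun := isDecreasingRun_reverse (h.pairwise.sublist (by simp)) h.left_ne_nil h.le_of_lt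
  obtain ⟨t, y, rfl⟩ := List.eq_nil_or_concat' t |>.resolve_left h.left_ne_nil
  have hyb : (a ++ y :: b).Pairwise (· < ·) := h.pairwise.of_cons.sublist (by simp)
  rw [List.reverse_concat] at hrun ⊢
  simpa using sw_append hyb h.right_ne_nil hrun

theorem des_eq (h : IsSwDecomposition a t b v) (hnd : (0 :: (a ++ v)).Nodup) :
    des (a ++ b ++ t.reverse ++ v) = t.length + des (a ++ v) := by
  obtain ⟨m, t, rfl⟩ := List.exists_cons_of_ne_nil h.left_ne_nil
  obtain ⟨b, x, rfl⟩ := List.eq_nil_or_concat' b |>.resolve_left h.right_ne_nil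
  have hv : ∀ q ∈ v.head?, q < m → q < a.getLastD 0 := by
    refine fun q hq hqm => (h.le_of_lt q hq hqm).lt_of_ne ?_
    rintro rfl
    exact (List.nodup_append.1 (show ((0 :: a) ++ v).Nodup from hnd)).2.2 _
      List.getLastD_mem_cons _ (List.mem_of_mem_head? hq) rfl
  have hdec : (x :: (t.reverse ++ [m])).Pairwise (· > ·) := by
    have hmx : (m :: t ++ [x]).Pairwise (· < ·) := h.pairwise.of_cons.sublist (by simp)
    simpa using List.pairwise_reverse.2 hmx
  have hpeak := des_peak (u := a ++ b) (v := v) (h.pairwise.of_cons.sublist (by simp)) hdec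
  rw [des_append_eq_des_cons (h.pairwise.of_cons.sublist (by simp)) hv]
  simpa using hpeak

end IsSwDecomposition

theorem IsWaveDatum.exists_isSwDecomposition (h : IsWaveDatum l j v) : ∃ a t b v',
    l = t ++ b ∧ j = t.length ∧ v = a ++ v' ∧ IsSwDecomposition a t b v' := by
  have ht : l.take j ≠ [] := by
    rw [← List.length_pos_iff, List.length_take_of_le h.lt_length.le]
    exact h.pos
  have hb : l.drop j ≠ [] := by
    rw [← List.length_pos_iff, List.length_drop]
    exact Nat.sub_pos_of_lt h.lt_length
  have hl := pairwise_zero_cons (h.nodup.sublist (by simp)) h.pairwise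
  obtain ⟨m, l', hml⟩ := List.exists_cons_of_ne_nil (l := l) (by rintro rfl; simp at ht)
  have hhead : (l.take j).headD 0 = m := by
    obtain ⟨j, rfl⟩ := Nat.exists_eq_add_of_le' h.pos
    simp [hml]
  obtain ⟨v', hv, ha, hle⟩ := exists_takeChain_append_eq (fun x y => x < y ∧ y < m) 0 v
  refine ⟨_, l.take j, l.drop j, v', (List.take_append_drop j l).symm,
    (List.length_take_of_le h.lt_length.le).symm, hv.symm, ?_, ht, hb, fun q hq hqm => ?_⟩
  · rw [List.take_append_drop, pairwise_zero_cons_append]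
    refine ⟨List.isChain_iff_pairwise.1 (ha.imp fun _ _ h => h.1), h.pairwise, fun z hz => ?_⟩
    have ham := ha.induction (· < m) _ (fun _ _ h _ => h.2)
      fun _ => List.rel_of_pairwise_cons hl (by simp [hml])
    refine (ham _ List.getLastD_mem_cons).trans_le ?_
    have hml' : (m :: l').Pairwise (· ≤ ·) := hml ▸ h.pairwise.imp le_of_lt
    rcases List.mem_cons.1 (hml ▸ hz) with rfl | hz
    exacts [le_rfl, List.rel_of_pairwise_cons hml' hz]
  · rw [hhead] at hqm
    exact not_lt.1 fun hlt => hle q hq ⟨hlt, hqm⟩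

theorem exists_eq_append_append_cons (hw : (0 :: w).Nodup) (hinc : ¬ w.Pairwise (· < ·)) :
    ∃ a b y s, w = a ++ b ++ y :: s ∧ (0 :: (a ++ y :: b)).Pairwise (· < ·) ∧ b ≠ [] := by
  obtain ⟨u, x, y, s, rfl, hux, hyx⟩ := exists_first_descent hw.of_cons hinc
  have hnd : (y :: 0 :: (u ++ [x])).Nodup :=
    (List.perm_append_singleton y (0 :: (u ++ [x]))).nodup_iff.1 (hw.sublist (by simp))
  obtain ⟨a, b, hab, hyb⟩ := exists_append_cons_pairwise (c := y) hux
    fun hy => (List.nodup_cons.1 hnd).1 (List.mem_cons_of_mem 0 hy)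
  refine ⟨a, b, y, s, by simp [← hab], pairwise_zero_cons ?_ hyb, ?_⟩
  · rw [hab] at hnd
    exact (List.perm_middle (l₁ := 0 :: a)).nodup_iff.2 hnd
  · rintro rfl
    rw [List.append_nil] at hab
    exact ((List.pairwise_append.1 hyb).2.2 x (by simp [← hab]) y (by simp)).not_gt hyx

theorem exists_isSwDecomposition (hw : (0 :: w).Nodup) (hinc : ¬ w.Pairwise (· < ·)) :
    ∃ a t b v, w = a ++ b ++ t.reverse ++ v ∧ IsSwDecomposition a t b v := by
  obtain ⟨a, b, y, s, rfl, hayb, hb⟩ := exists_eq_append_append_cons hw hinc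
  obtain ⟨ha, hyb, hlt⟩ := pairwise_zero_cons_append.1 hayb
  obtain ⟨d, v, rfl, hd⟩ := exists_isDecreasingRun_append (d := [y]) (by simp) (by simp)
    (p := a.getLastD 0) (by simpa using hlt y (by simp)) s
  refine ⟨a, (y :: d).reverse, b, v, by simp, ?_, by simp, hb, ?_⟩
  · have hyd : ∀ z ∈ y :: d, z ≤ y := by
      simpa using fun z hz => (List.rel_of_pairwise_cons hd.pairwise hz).le
    rw [pairwise_zero_cons_append, List.pairwise_append, List.pairwise_reverse]
    refine ⟨ha, ⟨hd.pairwise, hyb.of_cons, fun z hz z' hz' => ?_⟩, fun z hz => ?_⟩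
    · exact (hyd z (List.mem_reverse.1 hz)).trans_lt (List.rel_of_pairwise_cons hyb hz')
    · rcases List.mem_append.1 hz with hz | hz
      exacts [hd.lt z (List.mem_reverse.1 hz), hlt z (List.mem_cons_of_mem y hz)]
  · simpa [List.getLastD_eq_getLast?, List.getLast?_cons] using hd.le_of_lt

theorem append_append_reverse_append_perm (a b t v : List ℕ) :
    a ++ b ++ t.reverse ++ v ~ t ++ b ++ (a ++ v) := by
  rw [List.perm_iff_count]
  intro x
  simp only [List.count_append, List.count_reverse]
  ring

theorem exists_swCode_eq (hw : (0 :: w).Nodup) (hinc : ¬ w.Pairwise (· < ·)) :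
    ∃ l j v, IsWaveDatum l j v ∧ swCode l j v = w := by
  obtain ⟨a, t, b, v, rfl, h⟩ := exists_isSwDecomposition hw hinc
  refine ⟨t ++ b, t.length, a ++ v, ⟨h.pairwise.of_cons.sublist (by simp),
    ((append_append_reverse_append_perm a b t v).cons 0).nodup_iff.1 hw,
    List.length_pos_iff.2 h.left_ne_nil, ?_⟩, h.swCode_eq⟩
  rw [List.length_append]
  exact Nat.lt_add_of_pos_right (List.length_pos_iff.2 h.right_ne_nil)

theorem isWaveCoding_sw : IsWaveCoding des sw swCode where
  stat_of_pairwise := des_eq_zero_of_pairwise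
  wave_of_pairwise := sw_of_pairwise
  perm_code h := by
    obtain ⟨a, t, b, v, rfl, rfl, rfl, hd⟩ := h.exists_isSwDecomposition
    rw [hd.swCode_eq]
    exact append_append_reverse_append_perm a b t v
  sublist_code h := by
    obtain ⟨a, t, b, v, rfl, rfl, rfl, hd⟩ := h.exists_isSwDecomposition
    rw [hd.swCode_eq]
    simp
  perm_wave h := by
    obtain ⟨a, t, b, v, rfl, rfl, rfl, hd⟩ := h.exists_isSwDecomposition
    rw [hd.swCode_eq, hd.sw_eq]
    exact ((List.reverse_perm t).append_left b).trans List.perm_append_comm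
  stat_code h := by
    obtain ⟨a, t, b, v, rfl, rfl, rfl, hd⟩ := h.exists_isSwDecomposition
    rw [hd.swCode_eq, hd.des_eq (h.nodup.sublist (by simp))]
  exists_code_eq := exists_swCode_eq

end SwCoding

section IncreasingDecreasingPrefixes

variable {u r v w : List ℕ} {c m : ℕ}

theorem des_append_reverse_append_cons (h : (u ++ c :: r).Pairwise (· < ·)) (v : List ℕ) :
    des (u ++ r.reverse ++ c :: v) = r.length + des (c :: v) := by
  obtain ⟨-, hcr, -⟩ := List.pairwise_append.1 h
  rcases List.eq_nil_or_concat' r with rfl | ⟨r, x, rfl⟩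
  · rw [List.reverse_nil, List.append_nil, des_append_cons, des_eq_zero_of_pairwise h]
    rfl
  · have hpeak := des_peak (u := u) (x := x) (d := r.reverse) (y := c) (v := v)
      (h.sublist (by simp)) (by simpa using List.pairwise_reverse.2 hcr)
    simpa using hpeak

theorem length_le_length_srw_append (hu : u.Pairwise (· < ·)) (hw : (0 :: (u ++ v)).Nodup) :
    u.length ≤ (srw (u ++ v)).length := by
  by_cases hinc : (u ++ v).Pairwise (· < ·)
  · simp [srw_of_pairwise hinc]
  · obtain ⟨a, x, y, s, hv, hax, hyx⟩ := exists_first_descent hw.of_cons hinc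
    have hlt := (pairwise_zero_cons_append.1
      (pairwise_zero_cons (hw.sublist (by simp [hv])) hax)).2.2
    obtain ⟨e, v', he, hrun⟩ := exists_isDecreasingRun_append (by simp) (by simp) hlt (y :: s)
    have hsrw := srw_append (r := s) hax hyx (by simp [he]) hrun
    rw [show a ++ ([x] ++ e) ++ v' = u ++ v by simp [hv, he]] at hsrw
    by_contra! hlen
    rw [hsrw] at hlen
    have hpre : a ++ [x, y] <+: u := List.prefix_of_prefix_length_le
      (by rw [hv]; exact ⟨s, by simp⟩) (List.prefix_append u v) (by
        simp only [List.length_append, List.length_cons, List.length_nil] at hlen ⊢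
        omega)
    have hxy : [x, y].Pairwise (· < ·) := hu.sublist ((by simp : [x, y] <+ a ++ [x, y]).trans
      hpre.sublist)
    exact hyx.not_gt (List.rel_of_pairwise_cons hxy (by simp))

theorem length_le_length_srw_append_reverse_append {t : List ℕ}
    (h : (0 :: (u ++ t)).Pairwise (· < ·)) (ht : 1 < t.length) (v : List ℕ) :
    (u ++ t).length ≤ (srw (u ++ t.reverse ++ v)).length := by
  obtain ⟨s, x, rfl⟩ := List.eq_nil_or_concat' t |>.resolve_left (by rintro rfl; simp at ht)
  obtain ⟨s, y, rfl⟩ := List.eq_nil_or_concat' s |>.resolve_left (by rintro rfl; simp at ht)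
  obtain ⟨-, hs, hlt⟩ := pairwise_zero_cons_append.1 h
  have hyx : y < x := (List.pairwise_append.1 hs).2.2 y (by simp) x (by simp)
  obtain ⟨e, v', rfl, hrun⟩ := exists_isDecreasingRun_append (by simp)
    (List.pairwise_reverse.2 hs) (fun z hz => hlt z (List.mem_reverse.1 hz)) v
  have hsrw := srw_append (r := s.reverse ++ e ++ v') (h.of_cons.sublist (by simp)) hyx
    (by simp) hrun
  rw [← List.append_assoc _ e, List.append_assoc u _ e, hsrw, ← List.append_assoc]
  simp

theorem lt_length_srw_append_reverse_append_cons (h : (u ++ c :: r).Pairwise (· < ·))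
    (hw : (0 :: (u ++ r.reverse ++ c :: v)).Nodup) :
    u.length + r.length < (srw (u ++ r.reverse ++ c :: v)).length := by
  rw [← Nat.succ_le_iff]
  rcases eq_or_ne r [] with rfl | hr
  · rw [List.reverse_nil, List.append_nil, List.append_cons] at hw ⊢
    simpa using length_le_length_srw_append h hw
  · have hperm : u ++ r.reverse ++ c :: v ~ u ++ c :: r ++ v := by
      simpa using ((List.reverse_perm (c :: r)).append_right v).append_left u
    have h₀ := pairwise_zero_cons
      (((hperm.cons 0).nodup_iff.1 hw).sublist (by simp)) h
    simpa [Nat.add_assoc] using length_le_length_srw_append_reverse_append h₀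
      (by simpa using List.length_pos_iff.2 hr) v

theorem exists_eq_append_reverse_append_cons (hw : (0 :: w).Nodup) (hm : m < (srw w).length) :
    ∃ u c r v, w = u ++ r.reverse ++ c :: v ∧ (u ++ c :: r).Pairwise (· < ·) ∧
      u.length + r.length = m := by
  obtain ⟨a, t, v, rfl, hat, hlen⟩ : ∃ a t v, w = a ++ t.reverse ++ v ∧
      (a ++ t).Pairwise (· < ·) ∧ m < a.length + t.length := by
    by_cases hinc : w.Pairwise (· < ·)
    · exact ⟨w, [], [], by simp, by simpa, by simpa [srw_of_pairwise hinc] using hm⟩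
    · obtain ⟨a, t, x, v, rfl, hat, hx, hv⟩ := exists_eq_append_reverse_append hw hinc
      rw [srw_reverse_append hat hx hv] at hm
      exact ⟨a, t ++ [x], v, rfl, hat.of_cons, by simpa using hm⟩
  rcases lt_or_ge m a.length with hma | hma
  · obtain ⟨u, c, a, rfl, rfl⟩ := exists_eq_append_cons hma
    exact ⟨u, c, [], a ++ t.reverse ++ v, by simp, hat.sublist (by simp), rfl⟩
  · obtain ⟨r, c, t', ht, hr⟩ := exists_eq_append_cons (l := t.reverse) (j := m - a.length)
      (by rw [List.length_reverse]; omega)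
    obtain rfl : t = t'.reverse ++ c :: r.reverse := by
      rw [← List.reverse_reverse t, ht]
      simp
    exact ⟨a, c, r.reverse, t' ++ v, by simp, hat.sublist (by simp),
      by rw [List.length_reverse, hr]; omega⟩

end IncreasingDecreasingPrefixes

section Semipermutations

variable {u r : List ℕ} {α : Finset ℕ} {c n m k i : ℕ}

/-- The word of a semipermutation `(α₀, ρ)`: the letters of `α₀` below `ρ₁` in increasing order,
those above `ρ₁` in decreasing order, and `ρ`. -/
def semiWord (p : Finset ℕ × List ℕ) : List ℕ :=
  (p.1.filter (· < letter p.2 1)).sort ++ (p.1.filter (letter p.2 1 < ·)).sort.reverse ++ p.2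

theorem semiWord_cons (α : Finset ℕ) (c : ℕ) (v : List ℕ) : semiWord (α, c :: v) =
    (α.filter (· < c)).sort ++ (α.filter (c < ·)).sort.reverse ++ c :: v :=
  rfl

theorem nodup_zero_cons_range' (n : ℕ) : (0 :: List.range' 1 n).Nodup :=
  List.nodup_cons.2 ⟨by simp, List.nodup_range'⟩

theorem pairwise_sort_filter_append_cons (α : Finset ℕ) (c : ℕ) :
    ((α.filter (· < c)).sort ++ c :: (α.filter (c < ·)).sort).Pairwise (· < ·) := by
  have hlt : ∀ x ∈ (α.filter (· < c)).sort, x < c := by simp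
  have hgt : ∀ x ∈ (α.filter (c < ·)).sort, c < x := by simp
  refine List.pairwise_append.2 ⟨(Finset.sortedLT_sort _).pairwise,
    List.pairwise_cons.2 ⟨hgt, (Finset.sortedLT_sort _).pairwise⟩, fun x hx y hy => ?_⟩
  rcases List.mem_cons.1 hy with rfl | hy
  exacts [hlt x hx, (hlt x hx).trans (hgt y hy)]

theorem des_semiWord (α : Finset ℕ) (c : ℕ) (v : List ℕ) :
    des (semiWord (α, c :: v)) = semides (α, c :: v) := by
  rw [semiWord_cons, des_append_reverse_append_cons (pairwise_sort_filter_append_cons α c) v,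
    Finset.length_sort, add_comm]
  rfl

theorem semiWord_perm (hc : c ∉ α) (v : List ℕ) : semiWord (α, c :: v) ~ α.toList ++ c :: v := by
  refine List.Perm.append_right _ ((List.reverse_perm _).append_left _ |>.trans ?_)
  have hnd : ((α.filter (· < c)).sort ++ (α.filter (c < ·)).sort).Nodup :=
    ((pairwise_sort_filter_append_cons α c).sublist (by simp)).imp ne_of_lt
  refine (List.perm_ext_iff_of_nodup hnd α.nodup_toList).2 fun x => ?_
  simp only [List.mem_append, Finset.mem_sort, Finset.mem_filter, Finset.mem_toList, ← and_or_left,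
    and_iff_left_iff_imp]
  intro hx
  exact lt_or_gt_of_ne (ne_of_mem_of_not_mem hx hc)

theorem semiWord_toFinset (h : (u ++ c :: r).Pairwise (· < ·)) (v : List ℕ) :
    semiWord ((u ++ r).toFinset, c :: v) = u ++ r.reverse ++ c :: v := by
  obtain ⟨hu, hcr, huc⟩ := List.pairwise_append.1 h
  have huc : ∀ x ∈ u, x < c := fun x hx => huc x hx c (by simp)
  obtain ⟨hcr, hr⟩ := List.pairwise_cons.1 hcr
  have hlt : (u ++ r).toFinset.filter (· < c) = u.toFinset := by
    rw [List.toFinset_append, Finset.filter_union, Finset.filter_true_of_mem (by simpa using huc),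
      Finset.filter_false_of_mem (by simpa using fun x hx => (hcr x hx).le), Finset.union_empty]
  have hgt : (u ++ r).toFinset.filter (c < ·) = r.toFinset := by
    rw [List.toFinset_append, Finset.filter_union, Finset.filter_true_of_mem (s := r.toFinset)
      (by simpa using hcr), Finset.filter_false_of_mem
      (by simpa using fun x hx => (huc x hx).le), Finset.empty_union]
  rw [semiWord_cons, hlt, hgt, (List.toFinset_sort _ (hu.imp ne_of_lt)).2 (hu.imp le_of_lt),
    (List.toFinset_sort _ (hr.imp ne_of_lt)).2 (hr.imp le_of_lt)]

theorem mem_semiperms_iff {p : Finset ℕ × List ℕ} :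
    p ∈ semiperms n m ↔ p.2.length = m ∧ p.1.toList ++ p.2 ~ List.range' 1 n := by
  obtain ⟨α, ρ⟩ := p
  have hIcc (x) : x ∈ List.range' 1 n ↔ x ∈ Finset.Icc 1 n := by
    rw [List.mem_range'_1, Finset.mem_Icc, Nat.lt_one_add_iff]
  refine and_congr_right fun _ => ⟨?_, fun h => ?_⟩
  · rintro ⟨hnd, hmem, h⟩
    dsimp only at hnd hmem h ⊢
    subst h
    refine (List.perm_ext_iff_of_nodup (List.nodup_append'.2 ⟨Finset.nodup_toList _, hnd,
      fun x hx => by simp_all⟩) List.nodup_range').2 fun x => ?_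
    rw [List.mem_append, Finset.mem_toList, Finset.mem_sdiff, List.mem_toFinset, hIcc]
    have := hmem x
    tauto
  · obtain ⟨-, hnd, hdisj⟩ := List.nodup_append'.1 (h.nodup_iff.2 List.nodup_range')
    have hmem (x) : x ∈ α ∨ x ∈ ρ ↔ x ∈ Finset.Icc 1 n := by
      rw [← hIcc, ← h.mem_iff, List.mem_append, Finset.mem_toList]
    refine ⟨hnd, fun x hx => (hmem x).1 (Or.inr hx), ?_⟩
    ext x
    have : x ∈ α → x ∉ ρ := fun hx => hdisj (Finset.mem_toList.2 hx)
    rw [Finset.mem_sdiff, List.mem_toFinset, ← hmem]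
    tauto

theorem mapsTo_semiWord :
    Set.MapsTo semiWord {p | p ∈ semiperms n (k + 1) ∧ semides p = i}
      {w | w ~ List.range' 1 n ∧ des w = i ∧ n - k ≤ (srw w).length} := by
  rintro ⟨α, ρ⟩ ⟨hp, hdes⟩
  obtain ⟨hlen, hp⟩ := mem_semiperms_iff.1 hp
  obtain ⟨c, v, rfl⟩ := List.exists_cons_of_length_eq_add_one hlen
  have hc : c ∉ α := fun hc => (List.nodup_append'.1 (hp.nodup_iff.2 List.nodup_range')).2.2
    (Finset.mem_toList.2 hc) List.mem_cons_self
  have hperm := (semiWord_perm hc v).trans hp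
  have hnd : (0 :: semiWord (α, c :: v)).Nodup :=
    (hperm.cons 0).nodup_iff.2 (nodup_zero_cons_range' n)
  have hn := hperm.length_eq
  refine ⟨hperm, (des_semiWord α c v).trans hdes, ?_⟩
  rw [semiWord_cons] at hnd hn ⊢
  have hsrw := lt_length_srw_append_reverse_append_cons (pairwise_sort_filter_append_cons α c) hnd
  simp only [List.length_append, List.length_reverse, List.length_range', hlen] at hn
  omega

theorem injOn_semiWord : Set.InjOn semiWord (semiperms n m) := by
  rintro ⟨α, ρ⟩ ⟨hlen, -, -, hα⟩ ⟨β, π⟩ ⟨hlen', -, -, hβ⟩ h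
  obtain rfl : ρ = π := List.append_inj_right' h (hlen.trans hlen'.symm)
  exact Prod.ext (hα.trans hβ.symm) rfl

theorem surjOn_semiWord (hk : k < n) :
    Set.SurjOn semiWord {p | p ∈ semiperms n (k + 1) ∧ semides p = i}
      {w | w ~ List.range' 1 n ∧ des w = i ∧ n - k ≤ (srw w).length} := by
  rintro w ⟨hw, hdes, hsrw⟩
  obtain ⟨u, c, r, v, rfl, h, hm⟩ := exists_eq_append_reverse_append_cons (m := n - (k + 1))
    ((hw.cons 0).nodup_iff.2 (nodup_zero_cons_range' n)) (by omega)
  have hlen := hw.length_eq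
  simp only [List.length_append, List.length_reverse, List.length_cons, List.length_range'] at hlen
  have hv : (c :: v).length = k + 1 := by
    rw [List.length_cons]
    omega
  have hword := semiWord_toFinset h v
  refine ⟨((u ++ r).toFinset, c :: v), ⟨mem_semiperms_iff.2 ⟨hv, ?_⟩, ?_⟩, hword⟩
  · refine (semiWord_perm ?_ v).symm.trans (hword ▸ hw)
    have hcuv : (c :: (u ++ r)).Nodup := List.perm_middle.nodup_iff.1 (h.imp ne_of_lt)
    simpa using (List.nodup_cons.1 hcuv).1
  · rw [← des_semiWord, hword, hdes]

theorem bijOn_semiWord (hk : k < n) (i : ℕ) :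
    Set.BijOn semiWord {p | p ∈ semiperms n (k + 1) ∧ semides p = i}
      {w | w ~ List.range' 1 n ∧ des w = i ∧ n - k ≤ (srw w).length} :=
  ⟨mapsTo_semiWord, injOn_semiWord.mono fun _ h => h.1, surjOn_semiWord hk⟩

end Semipermutations

section PermutationWords

variable {n : ℕ}

theorem word_perm (σ : Equiv.Perm (Fin n)) : word σ ~ List.range' 1 n := by
  have h : word (1 : Equiv.Perm (Fin n)) = List.range' 1 n := by
    refine List.ext_getElem (by simp [word]) fun j _ _ => ?_
    simp [word, add_comm]
  exact h ▸ Equiv.Perm.ofFn_comp_perm σ fun j => (j : ℕ) + 1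

theorem word_injective : Function.Injective (word (n := n)) := fun σ τ h => by
  ext j
  simpa using congrFun (List.ofFn_injective h) j

theorem exists_word_eq {w : List ℕ} (hw : w ~ List.range' 1 n) :
    ∃ σ : Equiv.Perm (Fin n), word σ = w := by
  have hlen : w.length = n := by simpa using hw.length_eq
  subst hlen
  have hmem (j : Fin w.length) : 1 ≤ w[j] ∧ w[j] - 1 < w.length := by
    obtain ⟨h₁, h₂⟩ := List.mem_range'_1.1 (hw.mem_iff.1 (List.getElem_mem j.isLt))
    exact ⟨h₁, (Nat.sub_lt_iff_lt_add' h₁).2 h₂⟩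
  let f : Fin w.length → Fin w.length := fun j => ⟨w[j] - 1, (hmem j).2⟩
  have hf : Function.Injective f := fun a b hab => by
    have hab : w[a] - 1 = w[b] - 1 := congrArg Fin.val hab
    exact Fin.ext ((hw.nodup_iff.2 List.nodup_range').getElem_inj_iff.1
      (Nat.sub_one_cancel (hmem a).1 (hmem b).1 hab))
  refine ⟨Equiv.ofBijective f (Finite.injective_iff_bijective.1 hf), ?_⟩
  refine List.ext_getElem (by simp [word]) fun j _ hj => ?_
  simpa [word, f] using Nat.sub_add_cancel (hmem ⟨j, hj⟩).1

theorem mk_perm_eq (n : ℕ) (Q : List ℕ → Prop) :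
    Cardinal.mk {σ : Equiv.Perm (Fin n) // Q (word σ)} =
      Cardinal.mk {w // w ~ List.range' 1 n ∧ Q w} := by
  have h : Set.BijOn (word (n := n)) {σ | Q (word σ)} {w | w ~ List.range' 1 n ∧ Q w} := by
    refine ⟨fun σ hσ => ⟨word_perm σ, hσ⟩, word_injective.injOn, ?_⟩
    rintro w ⟨hw, hQ⟩
    obtain ⟨σ, rfl⟩ := exists_word_eq hw
    exact ⟨σ, hQ, rfl⟩
  exact Cardinal.mk_congr h.equiv

end PermutationWords

end Eulerian

theorem mainTheorem1 (n k i : ℕ) (hk : k < n) (hi : 0 < i) :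
    Cardinal.mk {p : Finset ℕ × List ℕ // p ∈ Eulerian.semiperms n (k + 1) ∧
        Eulerian.semides p = i} =
      Cardinal.mk {σ : Equiv.Perm (Fin n) // Eulerian.des (Eulerian.word σ) = i ∧
        n - k ≤ (Eulerian.srw (Eulerian.word σ)).length} ∧
    Cardinal.mk {σ : Equiv.Perm (Fin n) // Eulerian.des (Eulerian.word σ) = i ∧
        n - k ≤ (Eulerian.srw (Eulerian.word σ)).length} =
      Cardinal.mk {σ : Equiv.Perm (Fin n) // Eulerian.des (Eulerian.word σ) = i ∧
        n - k ≤ (Eulerian.sw (Eulerian.word σ)).length} ∧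
    Cardinal.mk {σ : Equiv.Perm (Fin n) // Eulerian.des (Eulerian.word σ) = i ∧
        n - k ≤ (Eulerian.sw (Eulerian.word σ)).length} =
      Cardinal.mk {σ : Equiv.Perm (Fin n) // Eulerian.lec (Eulerian.word σ) = i ∧
        n - k ≤ (Eulerian.rightmostHook (Eulerian.word σ)).length} := by
  have hs := Eulerian.nodup_zero_cons_range' n
  rw [Eulerian.mk_perm_eq n fun w => Eulerian.des w = i ∧ n - k ≤ (Eulerian.srw w).length,
    Eulerian.mk_perm_eq n fun w => Eulerian.des w = i ∧ n - k ≤ (Eulerian.sw w).length,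
    Eulerian.mk_perm_eq n fun w => Eulerian.lec w = i ∧ n - k ≤ (Eulerian.rightmostHook w).length]
  exact ⟨Cardinal.mk_congr (Eulerian.bijOn_semiWord hk i).equiv,
    Eulerian.isWaveCoding_srw.mk_eq Eulerian.isWaveCoding_sw hs i _,
    Eulerian.isWaveCoding_sw.mk_eq Eulerian.isWaveCoding_hook hs i _⟩
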